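/- Let $A$ be a real $n\times n$ matrix and let $S=\mathbb{R}^n\rtimes_A\mathbb{R}$ be the Lie group with underlying manifold $\mathbb{R}^n\times\mathbb{R}$ and group law $(v,t)(w,s)=(v+e^{tA}w,\;t+s)$. Let $\Gamma\subset\mathbb{R}^n$ be a lattice (a discrete subgroup spanning $\mathbb{R}^n$) with $e^{A}\Gamma=\Gamma$, and let $\Gamma'=\Gamma\rtimes\mathbb{Z}=\{(v,k): v\in\Gamma,\ k\in\mathbb{Z}\}$ be the corresponding lattice in $S$. A nilmanifold is a compact quotient $N/H$ of a nilpotent Lie group $N$ by a closed subgroup $H$. Suppose that $e^{A}$ has a (complex) eigenvalue of absolute value different from $1$. Then $S/\Gamma'$ cannot be covered by a nilmanifold: no map from a nilmanifold to $S/\Gamma'$ is a covering map. In particular, $S/\Gamma'$ is not finitely covered by a nilmanifold. -/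

import Mathlib

open scoped Manifold ContDiff

/-- The underlying set `ℝⁿ × ℝ` of the solvable Lie group `S = ℝⁿ ⋊_A ℝ`. -/
@[ext]
structure SolvGroup {n : ℕ} (A : Matrix (Fin n) (Fin n) ℝ) where
  /-- the component in `ℝⁿ` -/
  vec : Fin n → ℝ
  /-- the component in `ℝ` -/
  time : ℝ

namespace SolvGroup

variable {n : ℕ} {A : Matrix (Fin n) (Fin n) ℝ}

/-- The one-parameter group `h(t) = Exp (tA)`. -/
noncomputable def flow (A : Matrix (Fin n) (Fin n) ℝ) (t : ℝ) : Matrix (Fin n) (Fin n) ℝ :=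
  NormedSpace.exp (t • A)

theorem flow_zero : flow A 0 = 1 := by
  simp [flow]

theorem flow_add (s t : ℝ) : flow A (s + t) = flow A s * flow A t := by
  unfold flow
  rw [add_smul]
  exact Matrix.exp_add_of_commute _ _ (((Commute.refl A).smul_left s).smul_right t)

theorem flow_one : flow A 1 = NormedSpace.exp A := by
  simp [flow]

theorem flow_neg_mul (t : ℝ) : flow A (-t) * flow A t = 1 := by
  rw [← flow_add, neg_add_cancel, flow_zero]

theorem continuous_flow : Continuous (flow A) := by
  open scoped Matrix.Norms.Operator in
  exact (NormedSpace.exp_continuous (𝔸 := Matrix (Fin n) (Fin n) ℝ)).comp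
    (continuous_id.smul continuous_const)

/-- The group law `(v, t) (w, s) = (v + h(t) w, t + s)`. -/
noncomputable instance : Mul (SolvGroup A) :=
  ⟨fun x y => ⟨x.vec + (flow A x.time).mulVec y.vec, x.time + y.time⟩⟩

noncomputable instance : One (SolvGroup A) := ⟨⟨0, 0⟩⟩

noncomputable instance : Inv (SolvGroup A) :=
  ⟨fun x => ⟨-(flow A (-x.time)).mulVec x.vec, -x.time⟩⟩

@[simp] theorem mul_vec (x y : SolvGroup A) :
    (x * y).vec = x.vec + (flow A x.time).mulVec y.vec := rfl
@[simp] theorem mul_time (x y : SolvGroup A) : (x * y).time = x.time + y.time := rfl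
@[simp] theorem one_vec : (1 : SolvGroup A).vec = 0 := rfl
@[simp] theorem one_time : (1 : SolvGroup A).time = 0 := rfl
@[simp] theorem inv_vec (x : SolvGroup A) :
    (x⁻¹).vec = -(flow A (-x.time)).mulVec x.vec := rfl
@[simp] theorem inv_time (x : SolvGroup A) : (x⁻¹).time = -x.time := rfl

noncomputable instance : Group (SolvGroup A) :=
  Group.ofLeftAxioms
    (fun x y z => by
      ext1
      · simp [flow_add, Matrix.mulVec_add, add_assoc]
      · simp [add_assoc])
    (fun x => by ext1 <;> simp [flow_zero])
    (fun x => by ext1 <;> simp)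

/-- The identification of `S` with `ℝⁿ × ℝ` as a set. -/
def equivProd : SolvGroup A ≃ (Fin n → ℝ) × ℝ where
  toFun x := (x.vec, x.time)
  invFun p := ⟨p.1, p.2⟩
  left_inv _ := rfl
  right_inv _ := rfl

/-- `S` carries the topology of `ℝⁿ × ℝ`. -/
instance : TopologicalSpace (SolvGroup A) :=
  TopologicalSpace.induced equivProd inferInstance

/-- The identification of `S` with `ℝⁿ × ℝ` as a topological space. -/
def homeomorphProd : SolvGroup A ≃ₜ (Fin n → ℝ) × ℝ :=
  equivProd.toHomeomorphOfIsInducing ⟨rfl⟩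

theorem continuous_vec : Continuous (vec : SolvGroup A → Fin n → ℝ) :=
  continuous_fst.comp homeomorphProd.continuous

theorem continuous_time : Continuous (time : SolvGroup A → ℝ) :=
  continuous_snd.comp homeomorphProd.continuous

instance : IsTopologicalGroup (SolvGroup A) where
  continuous_mul := by
    refine homeomorphProd.isInducing.continuous_iff.2 (Continuous.prodMk ?_ ?_)
    · exact (continuous_vec.comp continuous_fst).add
        ((continuous_flow.comp (continuous_time.comp continuous_fst)).matrix_mulVec
          (continuous_vec.comp continuous_snd))
    · exact (continuous_time.comp continuous_fst).add (continuous_time.comp continuous_snd)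
  continuous_inv := by
    refine homeomorphProd.isInducing.continuous_iff.2 (Continuous.prodMk ?_ ?_)
    · exact ((continuous_flow.comp continuous_time.neg).matrix_mulVec continuous_vec).neg
    · exact continuous_time.neg

/-- `Exp A` maps `Γ` onto itself. -/
def Preserves (A : Matrix (Fin n) (Fin n) ℝ) (Γ : Submodule ℤ (Fin n → ℝ)) : Prop :=
  (fun v => (NormedSpace.exp A).mulVec v) '' (Γ : Set (Fin n → ℝ)) = Γ

theorem Preserves.flow_intCast {Γ : Submodule ℤ (Fin n → ℝ)} (h : Preserves A Γ) (k : ℤ)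
    {v : Fin n → ℝ} (hv : v ∈ Γ) : (flow A k).mulVec v ∈ Γ := by
  have hp : ∀ w ∈ Γ, (flow A 1).mulVec w ∈ Γ := fun w hw => by
    rw [flow_one, ← SetLike.mem_coe, ← h]
    exact ⟨w, hw, rfl⟩
  have hm : ∀ w ∈ Γ, (flow A (-1)).mulVec w ∈ Γ := fun w hw => by
    rw [← SetLike.mem_coe, ← h] at hw
    obtain ⟨u, hu, rfl⟩ := hw
    simpa only [← flow_one, Matrix.mulVec_mulVec, flow_neg_mul, Matrix.one_mulVec,
      SetLike.mem_coe] using hu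
  induction k with
  | zero => simpa [flow_zero] using hv
  | succ k ih =>
    rw [Int.cast_add, add_comm, flow_add, ← Matrix.mulVec_mulVec, Int.cast_one]
    exact hp _ ih
  | pred k ih =>
    rw [Int.cast_sub, sub_eq_add_neg, add_comm, flow_add, ← Matrix.mulVec_mulVec, Int.cast_one]
    exact hm _ ih

/-- The subgroup `Γ' = Γ ⋊ ℤ = {(v, k) | v ∈ Γ, k ∈ ℤ}` of `S`, for `Γ` preserved by `Exp A`. -/
def latticeSubgroup (Γ : Submodule ℤ (Fin n → ℝ)) (h : Preserves A Γ) :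
    Subgroup (SolvGroup A) where
  carrier := {x | x.vec ∈ Γ ∧ ∃ k : ℤ, x.time = k}
  one_mem' := ⟨Γ.zero_mem, 0, by simp⟩
  mul_mem' := by
    rintro x y ⟨hx, k, hk⟩ ⟨hy, l, hl⟩
    refine ⟨Γ.add_mem hx ?_, k + l, by simp [hk, hl]⟩
    rw [hk]
    exact h.flow_intCast k hy
  inv_mem' := by
    rintro x ⟨hx, k, hk⟩
    refine ⟨Γ.neg_mem ?_, -k, by simp [hk]⟩
    rw [hk, ← Int.cast_neg]
    exact h.flow_intCast (-k) hx

end SolvGroup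

/-- A nilmanifold: a compact quotient `N / H` of a nilpotent (real, finite-dimensional) Lie group
`N` by a closed subgroup `H`. Neither connectedness of `N` nor discreteness of `H` is required, and
only the topology of the quotient is recorded. -/
def IsNilmanifold.{u} (X : Type u) [TopologicalSpace X] : Prop :=
  ∃ (m : ℕ) (N : Type u) (_ : Group N) (_ : TopologicalSpace N)
    (_ : ChartedSpace (EuclideanSpace ℝ (Fin m)) N) (_ : LieGroup (𝓡 m) ∞ N) (H : Subgroup N),
    Group.IsNilpotent N ∧ IsClosed (H : Set N) ∧ CompactSpace (N ⧸ H) ∧ Nonempty (X ≃ₜ N ⧸ H)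

/-!
Let `q : N → N / H = X` be the quotient map and `p : X → S / Γ'` a covering. As `S` is simply
connected, its projection to `S / Γ'` (translated so as to match base points) factors as `p ∘ σ`
with `σ : S → X`. Let `Λ` be the group of those `l` in `S` whose right translation is a deck
transformation of `σ`.

The point is that `Λ` is nilpotent (`isNilpotent_rightPeriods`), which needs no structure theory of
nilpotent Lie groups. Paths in `N` from `1` form a nilpotent group under pointwise multiplication.
Sending a path `γ` to the endpoint of the lift of `q ∘ γ` through `σ` is a homomorphism to `Λ` on
the paths for which the endpoint lies in `Λ`: lift the square `γ₁ a * γ₂ b` and compare its diagonal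
with two of its sides (`monodromySubgroup`). It is onto `Λ` because every point of `S` is
the endpoint of such a lift (`exists_path_lift_eq`).

As `X` is compact, `p` has finite fibres, so every element of `Γ'` has a positive power in `Λ`
(`exists_pow_mem_rightPeriods`). In particular `Λ` contains some `(0, k)` with `k > 0` and, for each
`v ∈ Γ`, a multiple `(m v, 0)`. Iterated commutators of these give `(1 - Exp A ^ k) ^ c = 0`, where
`c` bounds the nilpotency class (`SolvGroup.exists_one_sub_exp_pow_eq_zero`). So every eigenvalue of
`Exp A` is a root of unity.
-/

open Topology

/-! ### Lifting paths in a group through a covering of a quotient -/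

/-- If `p` and `p ∘ σ` are covering maps, then `σ` has the lifting property of covering maps: lift
`p ∘ f` through `p ∘ σ` and use uniqueness of lifts through `p`. -/
theorem IsCoveringMap.exists_lift_of_comp {S X B A : Type*} [TopologicalSpace S]
    [TopologicalSpace X] [TopologicalSpace B] [TopologicalSpace A] [SimplyConnectedSpace A]
    [LocallyPathConnectedSpace A] {p : X → B} {σ : S → X} (hp : IsCoveringMap p)
    (hσ : Continuous σ) (hpσ : IsCoveringMap (p ∘ σ)) (f : C(A, X)) (a₀ : A) (s₀ : S)
    (h : σ s₀ = f a₀) : ∃ F : C(A, S), F a₀ = s₀ ∧ ∀ a, σ (F a) = f a := by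
  obtain ⟨F, ⟨hF₀, hF⟩, -⟩ := hpσ.existsUnique_continuousMap_lifts
    (⟨p ∘ f, hp.continuous.comp f.continuous⟩ : C(A, B)) a₀ s₀ (congrArg p h)
  refine ⟨F, hF₀, congrFun (hp.eq_of_comp_eq (hσ.comp F.continuous) f.continuous hF a₀ ?_)⟩
  simp [hF₀, h]

/-- Two lifts through `σ` of the same map on a connected space agree as soon as they agree at one
point. -/
theorem IsCoveringMap.lift_unique_of_comp {S X B A : Type*} [TopologicalSpace S]
    [TopologicalSpace X] [TopologicalSpace B] [TopologicalSpace A] [PreconnectedSpace A]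
    {p : X → B} {σ : S → X} (hpσ : IsCoveringMap (p ∘ σ)) {g₁ g₂ : A → S} (h₁ : Continuous g₁)
    (h₂ : Continuous g₂) (h : ∀ a, σ (g₁ a) = σ (g₂ a)) {a₀ : A} (h₀ : g₁ a₀ = g₂ a₀) (a : A) :
    g₁ a = g₂ a :=
  congrFun (hpσ.eq_of_comp_eq h₁ h₂ (funext fun b => congrArg p (h b)) a₀ h₀) a

/-- Every point of the connected space `S` is the endpoint of the `σ`-lift of a path in the group
`N` starting at `1`. No path lifting along `q : N → N / H` is needed: the set of
such endpoints is open and closed, because near any of its points two endpoints differ by a short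
path in `N`. Paths are parametrised by `ℝ`, their endpoints being the values at `0` and `1`. -/
theorem exists_path_lift_eq {N S X B : Type*} [Group N] [TopologicalSpace N]
    [IsTopologicalGroup N] [LocallyPathConnectedSpace N] [TopologicalSpace S]
    [PreconnectedSpace S] [TopologicalSpace X] [TopologicalSpace B] {H : Subgroup N} {q : N → X}
    (hq : IsOpenQuotientMap q) (hqH : ∀ a b, q a = q b ↔ a⁻¹ * b ∈ H) {p : X → B} {σ : S → X}
    (hp : IsCoveringMap p) (hσ : Continuous σ) (hpσ : IsCoveringMap (p ∘ σ)) {s₀ : S}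
    (h₀ : σ s₀ = q 1) (s : S) :
    ∃ (γ : C(ℝ, N)) (δ : C(ℝ, S)), γ 0 = 1 ∧ δ 0 = s₀ ∧ δ 1 = s ∧ ∀ t, σ (δ t) = q (γ t) := by
  have hloc : IsLocalHomeomorph σ :=
    hpσ.isLocalHomeomorph.of_comp hp.isLocalHomeomorph hσ
  set D : Set S := {s | ∃ (γ : C(ℝ, N)) (δ : C(ℝ, S)), γ 0 = 1 ∧ δ 0 = s₀ ∧ δ 1 = s ∧
    ∀ t, σ (δ t) = q (γ t)}
  have key : ∀ x : S, ∃ V ∈ 𝓝 x, ∀ y ∈ V, ∀ z ∈ V, y ∈ D → z ∈ D := by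
    intro x
    obtain ⟨g, hg⟩ := hq.surjective (σ x)
    obtain ⟨e, hxe, he⟩ := hloc x
    have hT : q ⁻¹' e.target ∈ 𝓝 g := by
      refine hq.continuous.continuousAt.preimage_mem_nhds (e.open_target.mem_nhds ?_)
      rw [hg, he]
      exact e.map_source hxe
    obtain ⟨W, ⟨hW, hWc⟩, hWT⟩ := (path_connected_basis g).mem_iff.1 hT
    refine ⟨e.source ∩ σ ⁻¹' (q '' W), Filter.inter_mem (e.open_source.mem_nhds hxe)
      (hσ.continuousAt.preimage_mem_nhds ?_), ?_⟩
    · rw [← hg]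
      exact hq.isOpenMap.image_mem_nhds hW
    rintro y ⟨hye, u, hu, huy⟩ z ⟨hze, v, hv, hvz⟩ ⟨γ, δ, hγ0, hδ0, hδ1, hδ⟩
    obtain ⟨c, hc⟩ := hWc.joinedIn u hu v hv
    have hcT (t : ℝ) : q (c.extend t) ∈ e.target := by
      obtain ⟨r, hr⟩ : c.extend t ∈ Set.range c := c.extend_range ▸ Set.mem_range_self t
      exact hWT (hr ▸ hc r)
    -- `y` is both `δ 1` and the point over `q u`, so `γ 1` and `u` differ by an element of `H`.
    have hh : u⁻¹ * γ 1 ∈ H := (hqH _ _).1 (by rw [huy, ← hδ, hδ1])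
    let Φ : C(ℝ × ℝ, N) := ⟨fun a => γ a.1 * (γ 1)⁻¹ * c.extend a.2 * (u⁻¹ * γ 1), by fun_prop⟩
    obtain ⟨F, hF0, hF⟩ := hp.exists_lift_of_comp hσ hpσ
      (⟨q ∘ Φ, hq.continuous.comp Φ.continuous⟩ : C(ℝ × ℝ, X)) (0, 0) s₀ (by simp [Φ, hγ0, h₀])
    replace hF : ∀ a, σ (F a) = q (Φ a) := hF
    have hleft : F (1, 0) = y := by
      rw [← hδ1]
      exact hpσ.lift_unique_of_comp (g₁ := fun a : ℝ => F (a, 0)) (g₂ := δ) (by fun_prop)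
        δ.continuous (fun a => by rw [hF, hδ]; simp [Φ, mul_assoc]) (a₀ := 0)
        (by rw [hF0, hδ0]) 1
    have hright : F (1, 1) = z := by
      have := hpσ.lift_unique_of_comp (g₁ := fun t : ℝ => F (1, t))
        (g₂ := fun t => e.symm (q (c.extend t))) (by fun_prop)
        (e.continuousOn_symm.comp_continuous (hq.continuous.comp (by fun_prop)) hcT)
        (fun t => by
          rw [hF, he, e.right_inv (hcT t), hqH]
          simpa [Φ, mul_assoc] using H.inv_mem hh) (a₀ := 0)
        (by rw [hleft, Path.extend_zero, huy, he, e.left_inv hye]) 1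
      rw [this, Path.extend_one, hvz, he, e.left_inv hze]
    exact ⟨⟨fun t => Φ (t, t), by fun_prop⟩, ⟨fun t => F (t, t), by fun_prop⟩,
      by simp [Φ, hγ0], hF0, hright, fun t => hF (t, t)⟩
  have hclopen : IsClopen D := by
    refine ⟨⟨isOpen_iff_mem_nhds.2 fun x hx => ?_⟩, isOpen_iff_mem_nhds.2 fun x hx => ?_⟩
    · obtain ⟨V, hV, h⟩ := key x
      exact Filter.mem_of_superset hV fun y hy hyD => hx (h y hy x (mem_of_mem_nhds hV) hyD)
    · obtain ⟨V, hV, h⟩ := key x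
      exact Filter.mem_of_superset hV fun y hy => h x (mem_of_mem_nhds hV) y hy hx
  have : s ∈ D := by
    rw [hclopen.eq_univ ⟨s₀, ContinuousMap.const ℝ 1, ContinuousMap.const ℝ s₀, rfl, rfl, rfl,
      fun _ => h₀⟩]
    trivial
  exact this

/-! ### Deck transformations given by right translations -/

/-- The right periods of a map `σ` on a group: the elements whose right translations are deck
transformations of `σ`. -/
def rightPeriods {S X : Type*} [Group S] (σ : S → X) : Subgroup S where
  carrier := {l | ∀ s, σ (s * l) = σ s}
  one_mem' := by simp
  mul_mem' := fun ha hb s => by rw [← mul_assoc, hb, ha]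
  inv_mem' := fun {a} ha s => by rw [← ha (s * a⁻¹), inv_mul_cancel_right]

theorem mem_rightPeriods {S X : Type*} [Group S] {σ : S → X} {l : S} :
    l ∈ rightPeriods σ ↔ ∀ s, σ (s * l) = σ s := Iff.rfl

/-- The pairs `(γ, l)` in which `γ` is a path from `1` in the group `N`, regarded as a function
`ℝ → N` and multiplied pointwise, and `l` is a right period of `σ` at which the lift through `σ`
of `q ∘ γ` starting at `1` ends (at time `1`). -/
def monodromySubgroup {N S X B : Type*} [Group N] [TopologicalSpace N]
    [IsTopologicalGroup N] [Group S] [TopologicalSpace S] [IsTopologicalGroup S]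
    [TopologicalSpace X] [TopologicalSpace B] {H : Subgroup N} {q : N → X}
    (hq : Continuous q) (hqH : ∀ a b, q a = q b ↔ a⁻¹ * b ∈ H) {p : X → B} {σ : S → X}
    (hp : IsCoveringMap p) (hσ : Continuous σ) (hpσ : IsCoveringMap (p ∘ σ))
    (h₁ : σ 1 = q 1) : Subgroup ((ℝ → N) × S) where
  carrier := {x | x.2 ∈ rightPeriods σ ∧ Continuous x.1 ∧ x.1 0 = 1 ∧
    ∃ δ : C(ℝ, S), δ 0 = 1 ∧ δ 1 = x.2 ∧ ∀ t, σ (δ t) = q (x.1 t)}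
  one_mem' := ⟨one_mem _, continuous_const, rfl, ContinuousMap.const ℝ 1, rfl, rfl, fun _ => h₁⟩
  mul_mem' := by
    rintro ⟨γ₁, l₁⟩ ⟨γ₂, l₂⟩ ⟨hl₁, hc₁, h10, δ₁, hδ₁0, hδ₁1, hδ₁⟩
      ⟨hl₂, hc₂, h20, δ₂, hδ₂0, hδ₂1, hδ₂⟩
    dsimp only at *
    have hend : γ₂ 1 ∈ H := by
      have : q 1 = q (γ₂ 1) := by rw [← hδ₂, hδ₂1, ← h₁, ← hl₂ 1, one_mul]
      simpa using (hqH _ _).1 this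
    -- Lift the square `γ₁ a * γ₂ b`: its diagonal is the product path, its sides `a = 0` and
    -- `b = 1` lift to `δ₂` and to the right translate of `δ₁` by `l₂`.
    let Φ : C(ℝ × ℝ, N) := ⟨fun a => γ₁ a.1 * γ₂ a.2, by fun_prop⟩
    obtain ⟨F, hF0, hF⟩ := hp.exists_lift_of_comp hσ hpσ
      (⟨q ∘ Φ, hq.comp Φ.continuous⟩ : C(ℝ × ℝ, X)) (0, 0) 1 (by simp [Φ, h10, h20, h₁])
    replace hF : ∀ a, σ (F a) = q (Φ a) := hF
    have hleft : F (0, 1) = l₂ := by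
      rw [← hδ₂1]
      exact hpσ.lift_unique_of_comp (g₁ := fun b : ℝ => F (0, b)) (g₂ := δ₂) (by fun_prop)
        δ₂.continuous (fun b => by rw [hF, hδ₂]; simp [Φ, h10]) (a₀ := 0) (by rw [hF0, hδ₂0]) 1
    have hright : F (1, 1) = l₁ * l₂ := by
      rw [← hδ₁1]
      refine hpσ.lift_unique_of_comp (g₁ := fun a : ℝ => F (a, 1)) (g₂ := fun a => δ₁ a * l₂)
        (by fun_prop) (by fun_prop) (fun a => ?_) (a₀ := 0) (by rw [hleft, hδ₁0, one_mul]) 1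
      rw [hF, hl₂, hδ₁, hqH]
      simpa [Φ] using hend
    exact ⟨mul_mem hl₁ hl₂, hc₁.mul hc₂, by simp [h10, h20],
      ⟨fun t => F (t, t), by fun_prop⟩, hF0, hright, fun t => hF (t, t)⟩
  inv_mem' := by
    rintro ⟨γ, l⟩ ⟨hl, hc, h0, δ, hδ0, hδ1, hδ⟩
    dsimp only at *
    have hend : γ 1 ∈ H := by
      have : q 1 = q (γ 1) := by rw [← hδ, hδ1, ← h₁, ← hl 1, one_mul]
      simpa using (hqH _ _).1 this
    have hl' := inv_mem hl
    -- The square `γ a * (γ b)⁻¹` is constant on the diagonal, and its side `b = 1` lifts to the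
    -- right translate of `δ` by `l⁻¹`.
    let Φ : C(ℝ × ℝ, N) := ⟨fun a => γ a.1 * (γ a.2)⁻¹, by fun_prop⟩
    obtain ⟨F, hF0, hF⟩ := hp.exists_lift_of_comp hσ hpσ
      (⟨q ∘ Φ, hq.comp Φ.continuous⟩ : C(ℝ × ℝ, X)) (0, 0) 1 (by simp [Φ, h0, h₁])
    replace hF : ∀ a, σ (F a) = q (Φ a) := hF
    have hdiag : F (1, 1) = 1 :=
      hpσ.lift_unique_of_comp (g₁ := fun a : ℝ => F (a, a)) (g₂ := fun _ => (1 : S))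
        (by fun_prop) continuous_const (fun a => by rw [hF, h₁]; simp [Φ]) (a₀ := 0) hF0 1
    have hside : F (0, 1) = l⁻¹ := by
      have := hpσ.lift_unique_of_comp (g₁ := fun a : ℝ => F (a, 1)) (g₂ := fun a => δ a * l⁻¹)
        (by fun_prop) (by fun_prop) (fun a => by
          rw [hF, hl', hδ, hqH]
          simpa [Φ] using hend) (a₀ := 1) (by rw [hdiag, hδ1, mul_inv_cancel]) 0
      rw [this, hδ0, one_mul]
    exact ⟨hl', hc.inv, by simp [h0], ⟨fun t => F (0, t), by fun_prop⟩, hF0, hside,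
      fun t => by rw [ContinuousMap.coe_mk, hF]; simp [Φ, h0]⟩

/-- If `N` is nilpotent and a covering `S → B` of a space `B` factors through a map `σ` to the
covering `X = N / H` of `B`, then the right periods of `σ` form a nilpotent group: they are the
monodromies of paths in `N`, which form a nilpotent group under pointwise multiplication. -/
theorem isNilpotent_rightPeriods {N S X B : Type*} [Group N] [TopologicalSpace N]
    [IsTopologicalGroup N] [LocallyPathConnectedSpace N] [hN : Group.IsNilpotent N] [Group S]
    [TopologicalSpace S] [IsTopologicalGroup S] [PreconnectedSpace S]
    [TopologicalSpace X] [TopologicalSpace B] {H : Subgroup N} {q : N → X}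
    (hq : IsOpenQuotientMap q) (hqH : ∀ a b, q a = q b ↔ a⁻¹ * b ∈ H) {p : X → B} {σ : S → X}
    (hp : IsCoveringMap p) (hσ : Continuous σ) (hpσ : IsCoveringMap (p ∘ σ))
    (h₁ : σ 1 = q 1) : Group.IsNilpotent (rightPeriods σ) := by
  let K := monodromySubgroup hq.continuous hqH hp hσ hpσ h₁
  have hpi : Group.IsNilpotent (ℝ → N) :=
    Group.isNilpotent_pi_of_bounded_class (Group.nilpotencyClass N) fun _ => le_rfl
  have hK : Group.IsNilpotent K := by
    -- The projection of `K` to the paths is injective by uniqueness of lifts.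
    refine Subgroup.isNilpotent_of_ker_le_center ((MonoidHom.fst (ℝ → N) S).comp K.subtype) ?_
    rintro ⟨⟨γ, l⟩, hl, hc, h0, δ, hδ0, hδ1, hδ⟩ hx
    obtain rfl : γ = 1 := hx
    have : l = 1 := by
      rw [show l = δ 1 from hδ1.symm]
      exact hpσ.lift_unique_of_comp (g₁ := δ) (g₂ := fun _ => (1 : S)) δ.continuous
        continuous_const (fun a => by rw [hδ, h₁]; rfl) hδ0 1
    subst this
    exact one_mem (Subgroup.center K)
  refine Group.nilpotent_of_surjective (G := K)
    (((MonoidHom.snd (ℝ → N) S).comp K.subtype).codRestrict (rightPeriods σ) fun x => x.2.1) ?_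
  rintro ⟨l, hl⟩
  obtain ⟨γ, δ, hγ0, hδ0, hδ1, hδ⟩ := exists_path_lift_eq hq hqH hp hσ hpσ h₁ l
  exact ⟨⟨⟨γ, l⟩, hl, γ.continuous, hγ0, δ, hδ0, hδ1, hδ⟩, rfl⟩

/-- If `σ` factors a covering that is invariant under right translation by `a`, and the fibre of
the second factor through `σ 1` is finite, then some power of `a` is a right period of `σ`. -/
theorem exists_pow_mem_rightPeriods {S X B : Type*} [Group S] [TopologicalSpace S]
    [IsTopologicalGroup S] [PreconnectedSpace S] [TopologicalSpace X] [TopologicalSpace B]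
    {p : X → B} {σ : S → X} (hp : IsCoveringMap p) (hσ : Continuous σ)
    (hfin : (p ⁻¹' {p (σ 1)}).Finite) {a : S} (ha : ∀ s, p (σ (s * a)) = p (σ s)) :
    ∃ k : ℕ, 0 < k ∧ a ^ k ∈ rightPeriods σ := by
  have hpow (k : ℕ) (s : S) : p (σ (s * a ^ k)) = p (σ s) := by
    induction k with
    | zero => simp
    | succ k ih => rw [pow_succ, ← mul_assoc, ha, ih]
  obtain ⟨i, j, hij, h⟩ : ∃ i j : ℕ, i < j ∧ σ (a ^ i) = σ (a ^ j) := by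
    have hm : Set.MapsTo (fun k : ℕ => σ (a ^ k)) Set.univ (p ⁻¹' {p (σ 1)}) := fun k _ => by
      simpa using hpow k 1
    obtain ⟨i, -, j, -, hne, h⟩ :=
      Set.infinite_univ.exists_ne_map_eq_of_mapsTo hm hfin
    rcases lt_or_gt_of_ne hne with hlt | hlt
    · exact ⟨i, j, hlt, h⟩
    · exact ⟨j, i, hlt, h.symm⟩
  refine ⟨j - i, by lia, fun s => ?_⟩
  -- The two lifts `σ (· * a ^ i)` and `σ (· * a ^ j)` of `p ∘ σ` agree at `1`, hence everywhere.
  have := congrFun (hp.eq_of_comp_eq (g₁ := fun s => σ (s * a ^ i)) (g₂ := fun s => σ (s * a ^ j))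
    (by fun_prop) (by fun_prop) (funext fun s => by simp [hpow]) 1 (by simpa using h))
    (s * (a ^ i)⁻¹)
  rw [inv_mul_cancel_right] at this
  rw [this, mul_assoc, pow_sub a hij.le, (Commute.refl a).pow_pow j i |>.inv_right.eq]

/-! ### The group `ℝⁿ ⋊ ℝ` -/

open scoped commutatorElement

namespace SolvGroup

variable {n : ℕ} {A : Matrix (Fin n) (Fin n) ℝ}

instance : ContractibleSpace (SolvGroup A) := homeomorphProd.contractibleSpace

instance : LocallyPathConnectedSpace (SolvGroup A) :=
  homeomorphProd.isOpenEmbedding.locallyPathConnectedSpace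

instance : T2Space (SolvGroup A) := homeomorphProd.isEmbedding.t2Space

theorem flow_natCast (k : ℕ) : flow A k = NormedSpace.exp A ^ k := by
  rw [← Matrix.exp_nsmul, flow, Nat.cast_smul_eq_nsmul]

theorem isDiscrete_latticeSubgroup (Γ : Submodule ℤ (Fin n → ℝ)) [DiscreteTopology Γ]
    (hΓ : Preserves A Γ) : IsDiscrete (latticeSubgroup Γ hΓ : Set (SolvGroup A)) := by
  refine ⟨?_⟩
  let f : latticeSubgroup Γ hΓ → Γ × Set.range ((↑) : ℤ → ℝ) := fun x =>
    (⟨x.1.vec, x.2.1⟩, ⟨x.1.time, x.2.2.imp fun _ h => h.symm⟩)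
  have : DiscreteTopology (Set.range ((↑) : ℤ → ℝ)) :=
    Int.isClosedEmbedding_coe_real.isInducing.isDiscrete_range.to_subtype
  refine DiscreteTopology.of_continuous_injective (f := f) ?_ fun x y h => ?_
  · exact ((continuous_vec.comp continuous_subtype_val).subtype_mk _).prodMk
      ((continuous_time.comp continuous_subtype_val).subtype_mk _)
  · simp only [f, Prod.mk.injEq, Subtype.mk.injEq] at h
    exact Subtype.ext (SolvGroup.ext h.1 (congrArg Subtype.val h.2))

theorem commutator_vec (w : Fin n → ℝ) (t : ℝ) :
    ⁅(⟨w, 0⟩ : SolvGroup A), (⟨0, t⟩ : SolvGroup A)⁆ = ⟨(1 - flow A t).mulVec w, 0⟩ := by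
  ext1
  · simp [commutatorElement_def, flow_zero, Matrix.sub_mulVec, Matrix.mulVec_neg, ← sub_eq_add_neg]
  · simp [commutatorElement_def]

theorem vec_pow (w : Fin n → ℝ) (m : ℕ) :
    (⟨w, 0⟩ : SolvGroup A) ^ m = ⟨(m : ℝ) • w, 0⟩ := by
  induction m with
  | zero => ext1 <;> simp
  | succ m ih => ext1 <;> simp [pow_succ, ih, flow_zero, add_smul]

/-- If a nilpotent subgroup of `ℝⁿ ⋊ ℝ` contains a positive power of every element of the lattice
`Γ ⋊ ℤ`, then some power of `Exp A` is unipotent: for `(0, k)` in the subgroup, taking commutators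
with `(0, k)` acts on the vector parts as `1 - Exp (kA)`. -/
theorem exists_one_sub_exp_pow_eq_zero {Γ : Submodule ℤ (Fin n → ℝ)} [DiscreteTopology Γ]
    [IsZLattice ℝ Γ] (hΓ : Preserves A Γ) (K : Subgroup (SolvGroup A)) [hK : Group.IsNilpotent K]
    (h : ∀ a ∈ latticeSubgroup Γ hΓ, ∃ k : ℕ, 0 < k ∧ a ^ k ∈ K) :
    ∃ k c : ℕ, 0 < k ∧ (1 - NormedSpace.exp A ^ k) ^ c = 0 := by
  have time_pow (k : ℕ) : (⟨0, 1⟩ : SolvGroup A) ^ k = ⟨0, k⟩ := by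
    induction k with
    | zero => ext1 <;> simp
    | succ k ih => ext1 <;> simp [pow_succ, ih]
  obtain ⟨k, hk, hkK⟩ := h ⟨0, 1⟩ ⟨Γ.zero_mem, 1, by simp⟩
  rw [time_pow] at hkK
  obtain ⟨c, hc⟩ := Subgroup.nilpotent_iff_lowerCentralSeries.1 hK
  refine ⟨k, c, hk, ?_⟩
  rw [← flow_natCast]
  -- The `i`-fold commutator of `(w, 0)` with `(0, k)` has vector part `(1 - Exp (kA)) ^ i w`.
  have hser (w : Fin n → ℝ) (hw : (⟨w, 0⟩ : SolvGroup A) ∈ K) (i : ℕ) :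
      ∃ hi : (⟨((1 - flow A k) ^ i).mulVec w, 0⟩ : SolvGroup A) ∈ K,
        (⟨_, hi⟩ : K) ∈ (⊤ : Subgroup K).lowerCentralSeries i := by
    induction i with
    | zero => exact ⟨by simpa using hw, trivial⟩
    | succ i ih =>
      obtain ⟨hi, hi'⟩ := ih
      have hcomm := Subgroup.commutator_mem_commutator hi'
        (Subgroup.mem_top (⟨⟨0, k⟩, hkK⟩ : K))
      have hval : (⁅(⟨_, hi⟩ : K), (⟨⟨0, k⟩, hkK⟩ : K)⁆ : K).1 =
          ⟨((1 - flow A k) ^ (i + 1)).mulVec w, 0⟩ := by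
        rw [pow_succ', ← Matrix.mulVec_mulVec, ← commutator_vec]
        rfl
      refine ⟨hval ▸ Subtype.property _, ?_⟩
      rw [Subgroup.lowerCentralSeries_succ]
      convert hcomm using 1
      exact Subtype.ext hval.symm
  have hzero (w : Fin n → ℝ) (hw : w ∈ Γ) : ((1 - flow A k) ^ c).mulVec w = 0 := by
    obtain ⟨m, hm, hmK⟩ := h ⟨w, 0⟩ ⟨hw, 0, by simp⟩
    rw [vec_pow] at hmK
    obtain ⟨hi, hi'⟩ := hser _ hmK c
    rw [hc, Subgroup.mem_bot] at hi'
    have : ((1 - flow A k) ^ c).mulVec ((m : ℝ) • w) = 0 :=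
      congrArg (fun x : K => x.1.vec) hi'
    rw [Matrix.mulVec_smul, smul_eq_zero] at this
    exact this.resolve_left (by positivity)
  have hlin : Matrix.toLin' ((1 - flow A k) ^ c) = 0 := by
    refine LinearMap.ext_on (s := (Γ : Set (Fin n → ℝ))) IsZLattice.span_top fun w hw => ?_
    rw [Matrix.toLin'_apply, hzero w hw, LinearMap.zero_apply]
  exact Matrix.toLin'.map_eq_zero_iff.1 hlin

end SolvGroup

theorem Matrix.norm_eq_one_of_one_sub_pow_eq_zero {n : ℕ} {E : Matrix (Fin n) (Fin n) ℝ}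
    {k c : ℕ} (hk : 0 < k) (h : (1 - E ^ k) ^ c = 0) {μ : ℂ}
    (hμ : Module.End.HasEigenvalue (Matrix.toLin' (E.map Complex.ofReal)) μ) : ‖μ‖ = 1 := by
  obtain ⟨v, hv⟩ := hμ.exists_hasEigenvector
  set T := Matrix.toLin' (E.map Complex.ofReal) with hT
  have hT0 : (1 - T ^ k) ^ c = 0 := by
    have h' := congrArg (fun M => Matrix.toLinAlgEquiv' (Complex.ofRealHom.mapMatrix M)) h
    rw [map_pow, map_pow, map_sub, map_sub, map_pow, map_pow, map_one, map_one, map_zero,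
      map_zero] at h'
    exact h'
  have hpow : ((1 - T ^ k) ^ c) v = (1 - μ ^ k) ^ c • v := by
    have hv' : Module.End.HasEigenvector (1 - T ^ k) (1 - μ ^ k) v := by
      refine ⟨Module.End.mem_eigenspace_iff.2 ?_, hv.2⟩
      rw [LinearMap.sub_apply, hv.pow_apply, sub_smul, one_smul, Module.End.one_apply]
    exact hv'.pow_apply c
  rw [hT0, LinearMap.zero_apply] at hpow
  have h0 : (1 - μ ^ k) ^ c = 0 := (smul_eq_zero.1 hpow.symm).resolve_right hv.2
  have h1 : μ ^ k = 1 := (sub_eq_zero.1 (eq_zero_of_pow_eq_zero h0)).symm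
  exact Complex.norm_eq_one_of_pow_eq_one h1 hk.ne'

/-! ### Coverings of `S / Γ'` by nilmanifolds -/

theorem mainTheorem2 {n : ℕ} (A : Matrix (Fin n) (Fin n) ℝ)
    (hA : ∃ μ : ℂ, Module.End.HasEigenvalue
      (Matrix.toLin' ((NormedSpace.exp A).map Complex.ofReal)) μ ∧ ‖μ‖ ≠ 1)
    (Γ : Submodule ℤ (Fin n → ℝ)) [DiscreteTopology Γ] [IsZLattice ℝ Γ]
    (hΓ : SolvGroup.Preserves A Γ)
    (X : Type*) [TopologicalSpace X] (hX : IsNilmanifold X)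
    (p : X → SolvGroup A ⧸ SolvGroup.latticeSubgroup Γ hΓ) :
    ¬ IsCoveringMap p := by
  intro hp
  obtain ⟨m, N, _, _, _, _, H, hN, -, hcomp, ⟨φ⟩⟩ := hX
  have : IsTopologicalGroup N := topologicalGroup_of_lieGroup (𝓡 m) ∞
  have : LocallyPathConnectedSpace N :=
    ChartedSpace.locallyPathConnectedSpace (EuclideanSpace ℝ (Fin m)) N
  have : CompactSpace X := φ.symm.compactSpace
  let Γ' := SolvGroup.latticeSubgroup Γ hΓ
  have hdisc : IsDiscrete (Γ' : Set (SolvGroup A)) := SolvGroup.isDiscrete_latticeSubgroup Γ hΓ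
  let q : N → X := fun g => φ.symm (g : N ⧸ H)
  have hq : IsOpenQuotientMap q :=
    φ.symm.isOpenQuotientMap.comp QuotientGroup.isOpenQuotientMap_mk
  have hqH (a b : N) : q a = q b ↔ a⁻¹ * b ∈ H := by
    simp only [q, φ.symm.injective.eq_iff, QuotientGroup.eq]
  obtain ⟨s₀, hs₀⟩ := QuotientGroup.mk_surjective (p (q 1))
  -- The universal covering of `S / Γ'`, based at the image of the base point of the nilmanifold.
  let π : SolvGroup A → SolvGroup A ⧸ Γ' := fun s => ((s₀ * s : SolvGroup A) : SolvGroup A ⧸ Γ')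
  have hπ : IsCoveringMap π :=
    (Γ'.isQuotientCoveringMap hdisc).isCoveringMap.comp_homeomorph (Homeomorph.mulLeft s₀)
  obtain ⟨σ, ⟨hσ1, hσ⟩, -⟩ := hp.existsUnique_continuousMap_lifts ⟨π, hπ.continuous⟩ 1 (q 1)
    (by rw [← hs₀]; exact congrArg QuotientGroup.mk (mul_one s₀).symm)
  replace hσ : p ∘ σ = π := hσ
  have hpσ : IsCoveringMap (p ∘ σ) := hσ ▸ hπ
  have hnil := isNilpotent_rightPeriods hq hqH hp σ.continuous hpσ hσ1
  have hfin : (p ⁻¹' {p (σ 1)}).Finite := by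
    have : IsClosed (Γ' : Set (SolvGroup A)) := by
      have := hdisc.to_subtype
      exact Subgroup.isClosed_of_discrete
    refine IsCompact.finite (IsClosed.isCompact (isClosed_singleton.preimage hp.continuous))
      ⟨(hp _).discreteTopology_fiber⟩
  obtain ⟨k, c, hk, hkc⟩ := SolvGroup.exists_one_sub_exp_pow_eq_zero hΓ (rightPeriods σ)
    fun a ha => exists_pow_mem_rightPeriods hp σ.continuous hfin fun s => by
      have (x : SolvGroup A) : p (σ x) = π x := congrFun hσ x
      rw [this, this, QuotientGroup.eq]
      simpa [mul_assoc] using Γ'.inv_mem ha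
  obtain ⟨μ, hμ, hμ1⟩ := hA
  exact hμ1 (Matrix.norm_eq_one_of_one_sub_pow_eq_zero hk hkc hμ)
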